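/- **Setting.** A game arena is a directed graph $G=(V,E)$ with $V=V_0\sqcup V_1$; Player $i$ moves at vertices of $V_i$. Strategies of Player 0 are functions of the history, a *positional* strategy depends on the current vertex only. A winning strategy from $v$ is one for which every play from $v$ played according to it is won by Player 0. A Streett game $(G,\Omega)$, $\Omega=((E_1,F_1),\dots,(E_n,F_n))$, $E_i,F_i\subseteq V$, is won by Player 0 on a play $\varrho$ iff for each $i$: $\mathrm{Inf}(\varrho)\cap F_i\ne\emptyset$ implies $\mathrm{Inf}(\varrho)\cap E_i\neq\emptyset$, where $\mathrm{Inf}(\varrho)$ is the set of vertices visited infinitely often. A (max-)parity game with colouring $c$ is won by Player 0 iff $\max c(\mathrm{Inf}(\varrho))$ is even. The *memory size* of a strategy from $v$ is the least number of states of a finite Mealy automaton that proposes the moves of the strategy along all plays from $v$ played according to it. **Parity simulation.** Suppose $E_n=F_n=V$. Let $S$ be the set of triples $s=((i_1\cdots i_n),e,f)$ with $(i_1\cdots i_n)$ a permutation of $1,\dots,n$ and $1\le e,f\le n$, and let $s_0=((1\cdots n),1,1)$. The parity game $\Gamma'$ of $\Gamma=(G,\Omega)$ is played on $S\times V$, where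 $(s,v)$ belongs to the owner of $v$. There is an edge from $(s,v)$ to $(s',v')$ iff $(v,v')\in E$ and $s'=((i'_1\cdots i'_n),e',f')$, where $(i'_1\cdots i'_n)$ arises from $(i_1\cdots i_n)$ by shifting all $i$ with $v\in E_i$ to the left (keeping the order otherwise), $e'$ is the maximal $l$ with $v\in E_{i_l}$ and $f'$ is the maximal $l$ with $v\in F_{i'_l}$. The colour of $(((i_1\cdots i_n),e,f),v)$ is $2e$ if $e\ge f$, and $2f-1$ if $e<f$. A positional strategy $f'$ in $\Gamma'$ *yields* the strategy in $\Gamma$ that updates the memory content along the history, starting with $s_0$, and plays the $V$-component of the move of $f'$. **Reduction.** Let $E'$ be the edge relation of $\Gamma'$ and put $c'=2n-c$, where $c$ is the colouring of $\Gamma'$. On $\mathbb N$ let $i\preceq j$ iff $i$ is even and $j$ odd, or both are even and $i\le j$, or both are odd and $j\le i$. In the simulation game positions are triples $(p,q,m)$ with $p,q\in S\times V$ and $m\in\mathbb N\cup\{\checkmark\}$; Spoiler moves from $(p,q,m)$ to $(p',q',m')$ such that $(p,p'),(q,q')\in E'$, $p'$ and $q'$ have the same $V$-component, and $m'=\mathrm{pm}(c'(p'),c'(q'),m)$.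 Here $\mathrm{pm}(i,j,\checkmark)$ is $\min\{i,j\}$ if $i\prec j$, and $\checkmark$ otherwise; for $m\in\mathbb N$, $\mathrm{pm}(i,j,m)$ is $\min\{i,j,m\}$ if $i\prec j$. If $j\preceq i$, it is $m$ if $i$ is odd, $i\le m$, and ($j$ is odd or $m<j$); it is $\checkmark$ if $j$ is even, $j\le m$, and ($i$ is even or $m<i$); it is $\checkmark$ if $i$ is odd, $j$ is even and $i,j\le m$; and it is $m$ in all other cases. Duplicator wins a play iff positions with $m=\checkmark$ are visited infinitely often. Write $p\le q$ if Duplicator wins from $(p,q,\mathrm{pm}(c'(p),c'(q),\checkmark))$, and $s\approx_S t$ if $(s,v)\le(t,v)$ and $(t,v)\le(s,v)$ for all $v\in V$. The *reduced game graph* $G''$ has vertex set $S/{\approx_S}\times V$ and an edge from $([s],v)$ to $([t],v')$ whenever $(v,v')\in E$ and $t$ is the least element, for a fixed total order on $S$, of the set of all $\hat t$ such that $((\hat s,v),(\hat t,v'))\in E'$ for some $\hat s\approx_S s$. Its *memory contents* are the elements of $S/{\approx_S}$. **The games $\Gamma_k$.** Let $k\ge1$. The arena $G_k$ has the vertices $v_j,p_j^+,p_j^-,w_j,r_j^+,r_j^-$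 ($1\le j\le k$) and $x,y$; exactly $w_1,\dots,w_k$ belong to Player 0. The edges are $v_j\to p_j^\pm$, $p_j^\pm\to v_{j+1}$ ($j<k$), $p_k^\pm\to w_1$, $w_j\to r_j^\pm$, $r_j^\pm\to w_{j+1}$ ($j<k$), $r_k^\pm\to x$, $x\to y$, $y\to v_1$. The pairs are, in this order, $(E_1,F_1),(E_{-1},F_{-1}),\dots,(E_k,F_k),(E_{-k},F_{-k}),(V,V)$, where $E_j=\{p_j^-,r_j^+,y\}$, $F_j=\{p_j^+,r_j^-\}$, $E_{-j}=\{p_j^+,r_j^-,y\}$, $F_{-j}=\{p_j^-,r_j^+\}$. Let $\Gamma_k$ be this Streett game and $\Gamma'_k$ its parity game. **Theorem.** For every $k\ge1$, Player 0 wins $\Gamma_k$ from $v_1$, and the following hold. 1. Let $f'$ be a positional winning strategy for Player 0 in $\Gamma'_k$ from $(s_0,v_1)$ such that no edge determined by her decisions leads into a vertex of odd colour; that is, whenever $(s,w)$ with $w\in V_0$ is reachable from $(s_0,v_1)$ under $f'$, both the vertex $f'(s,w)$ and its (unique) successor in $\Gamma'_k$ have an even colour. Then $f'$ yields a winning strategy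 for Player 0 in $\Gamma_k$ from $v_1$, and the memory size of this strategy is at least $2^k$. 2. The reduced game graph $G''_k$ of $\Gamma_k$ has only one memory content, for every choice of the total order on $S$. -/

import Mathlib

/-! ### Infinite games, strategies and their memory -/

/-- A game arena; the vertices outside `V0` belong to Player 1. -/
structure GameGraph (V : Type) where
  V0 : Set V
  edge : V → V → Prop

/-- An infinite game: an arena with the set of sequences that are winning for Player 0. -/
structure InfGame (V : Type) extends GameGraph V where
  win : Set (ℕ → V)

/-- The set of vertices visited infinitely often. -/
def infOcc {V : Type} (ρ : ℕ → V) : Set V := {v | ∃ᶠ i in Filter.atTop, ρ i = v}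

/-- The prefix `ρ(0) ⋯ ρ(i-1)`. -/
def pastOf {V : Type} (ρ : ℕ → V) (i : ℕ) : List V := (List.range i).map ρ

namespace GameGraph

variable {V : Type} (G : GameGraph V)

def IsPlay (ρ : ℕ → V) : Prop := ∀ i, G.edge (ρ i) (ρ (i + 1))

/-- Strategies for Player 0: `f h v` is the move after the history `h` followed by the current
vertex `v`. Only the values on play prefixes `h v` with `v ∈ V0` matter. -/
def IsStrategy (f : List V → V → V) : Prop :=
  ∀ h v, List.IsChain G.edge (h ++ [v]) → v ∈ G.V0 → G.edge v (f h v)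

def PlayedAccordingTo (f : List V → V → V) (ρ : ℕ → V) : Prop :=
  ∀ i, ρ i ∈ G.V0 → ρ (i + 1) = f (pastOf ρ i) (ρ i)

/-- `f` is a positional strategy for Player 0 (its values outside `V0` are irrelevant). -/
def IsPositionalStrategy (f : V → V) : Prop := ∀ v ∈ G.V0, G.edge v (f v)

/-- The edges that can be used when Player 0 follows the positional strategy `f`. -/
def positionalEdge (f : V → V) (p q : V) : Prop := G.edge p q ∧ (p ∈ G.V0 → q = f p)

/-- The vertices that are reachable from `p₀` when Player 0 follows `f`. -/
def reachableUnder (f : V → V) (p₀ : V) : Set V :=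
  {p | Relation.ReflTransGen (G.positionalEdge f) p₀ p}

/-- The edges determined by the decisions of Player 0 when she follows the positional strategy `f`
from `p₀`: the edges that she chooses, and the edges that follow immediately upon a chosen edge. -/
def determinedEdges (f : V → V) (p₀ : V) : Set (V × V) :=
  {a | a.1 ∈ G.reachableUnder f p₀ ∧ G.positionalEdge f a.1 a.2 ∧
    (a.1 ∈ G.V0 ∨ ∃ r ∈ G.reachableUnder f p₀, r ∈ G.V0 ∧ f r = a.1)}

end GameGraph

/-- `f` is a winning strategy for Player 0 from `v`. -/
def InfGame.IsWinningStrategy {V : Type} (Γ : InfGame V) (f : List V → V → V) (v : V) : Prop :=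
  Γ.IsStrategy f ∧
    ∀ ρ : ℕ → V, Γ.IsPlay ρ → ρ 0 = v → Γ.PlayedAccordingTo f ρ → ρ ∈ Γ.win

/-- Player 0 wins from `v`. -/
def InfGame.Wins {V : Type} (Γ : InfGame V) (v : V) : Prop := ∃ f, Γ.IsWinningStrategy f v

/-- Mealy automata reading vertices and proposing moves. -/
structure Mealy (V : Type) where
  Mem : Type
  init : Mem
  next : Mem → V → Mem
  out : Mem → V → V

/-- On every play from `v` according to `f`, the automaton proposes the moves of `f`. -/
def Mealy.Implements {V : Type} (M : Mealy V) (G : GameGraph V) (f : List V → V → V) (v : V) :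
    Prop :=
  ∀ ρ : ℕ → V, G.IsPlay ρ → ρ 0 = v → G.PlayedAccordingTo f ρ →
    ∀ i, ρ i ∈ G.V0 → M.out ((pastOf ρ i).foldl M.next M.init) (ρ i) = f (pastOf ρ i) (ρ i)

/-- Every (finite) Mealy automaton that implements `f` from `v` has at least `n` states. -/
def memorySizeAtLeast {V : Type} (G : GameGraph V) (f : List V → V → V) (v : V) (n : ℕ) : Prop :=
  ∀ M : Mealy V, Finite M.Mem → M.Implements G f v → n ≤ Nat.card M.Mem

/-- The (max-)parity game of a coloured arena. -/
def parityGame {V : Type} (G : GameGraph V) (c : V → ℕ) : InfGame V where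
  toGameGraph := G
  win := {ρ | ∃ m, IsGreatest (c '' infOcc ρ) m ∧ Even m}

/-! ### Streett games and their simulation by parity games -/

/-- A Streett game with `m + 1` pairs `(E j, F j)`. -/
structure StreettGame (V : Type) (m : ℕ) extends GameGraph V where
  E : Fin (m + 1) → Set V
  F : Fin (m + 1) → Set V

/-- Index appearance records over `m + 1` indices: a permutation `(i₁ ⋯ i_{m+1})`, where
`perm l` is the index at position `l`, and two pointers to positions. Positions are counted from
`0`, so that a pointer `e` stands for the number `e + 1`. -/
structure IAR (m : ℕ) where
  perm : Equiv.Perm (Fin (m + 1))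
  e : Fin (m + 1)
  f : Fin (m + 1)

/-- The record `((1 ⋯ m+1), 1, 1)`. -/
def IAR.initial (m : ℕ) : IAR m := ⟨1, 0, 0⟩

namespace StreettGame

variable {V : Type} {m : ℕ} (Γ : StreettGame V m)

/-- The Streett winning condition. -/
def game : InfGame V where
  toGameGraph := Γ.toGameGraph
  win := {ρ | ∀ j, (infOcc ρ ∩ Γ.F j).Nonempty → (infOcc ρ ∩ Γ.E j).Nonempty}

open Classical in
/-- All indices `i` with `v ∈ E i` are shifted to the left (`Tuple.sort` is stable, so the order
among the shifted indices and the order among the other ones are kept). -/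
noncomputable def shiftLeft (v : V) (π : Equiv.Perm (Fin (m + 1))) : Equiv.Perm (Fin (m + 1)) :=
  (Tuple.sort (fun l => if v ∈ Γ.E (π l) then (0 : ℕ) else 1)).trans π

open Classical in
/-- The memory update when vertex `v` is left: `e` is the maximal position in the old permutation
of an index `i` with `v ∈ E i`, and `f` the maximal position in the new permutation of an index `i`
with `v ∈ F i`. (These exist if one of the pairs consists of two copies of the whole vertex set.) -/
noncomputable def update (s : IAR m) (v : V) : IAR m where
  perm := Γ.shiftLeft v s.perm
  e := (Finset.univ.filter (fun l => v ∈ Γ.E (s.perm l))).sup id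
  f := (Finset.univ.filter (fun l => v ∈ Γ.F (Γ.shiftLeft v s.perm l))).sup id

/-- The arena of the simulating parity game. -/
def iarGraph : GameGraph (IAR m × V) where
  V0 := {p | p.2 ∈ Γ.V0}
  edge p q := Γ.edge p.2 q.2 ∧ q.1 = Γ.update p.1 p.2

end StreettGame

/-- The colouring of the simulating parity game. -/
def iarColor {V : Type} {m : ℕ} (p : IAR m × V) : ℕ :=
  if p.1.f ≤ p.1.e then 2 * ((p.1.e : ℕ) + 1) else 2 * ((p.1.f : ℕ) + 1) - 1

namespace StreettGame

variable {V : Type} {m : ℕ} (Γ : StreettGame V m)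

/-- The parity game that simulates the Streett game. -/
def simulatingGame : InfGame (IAR m × V) := parityGame Γ.iarGraph iarColor

/-- The strategy in the Streett game that a positional strategy `f'` in the simulating game yields:
the memory content is updated along the history, starting with the initial one, and the move is the
`V`-component of the move of `f'`. -/
noncomputable def inducedStrategy (f' : IAR m × V → IAR m × V) : List V → V → V :=
  fun h v => (f' (h.foldl Γ.update (IAR.initial m), v)).2

end StreettGame

/-! ### Right-hand delayed simulation -/

/-- The reward order `i ⪯ j`. -/
def rewardLE (i j : ℕ) : Prop :=
  (Even i ∧ Odd j) ∨ (Even i ∧ Even j ∧ i ≤ j) ∨ (Odd i ∧ Odd j ∧ j ≤ i)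

/-- The strict reward order `i ≺ j` (`i` is better than `j`). -/
def rewardLT (i j : ℕ) : Prop := rewardLE i j ∧ i ≠ j

open Classical in
/-- The priority memory update; `none` stands for the check mark. -/
noncomputable def pm (i j : ℕ) : Option ℕ → Option ℕ
  | none => if rewardLT i j then some (min i j) else none
  | some k =>
    if rewardLT i j then some (min (min i j) k)
    else if Odd i ∧ i ≤ k ∧ (Odd j ∨ k < j) then some k
    else if Even j ∧ j ≤ k ∧ (Even i ∨ k < i) then none
    else if Odd i ∧ Even j ∧ i ≤ k ∧ j ≤ k then none
    else some k

section Reduction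

variable {S V : Type}

/-- The right-hand delayed simulation game for a coloured arena over `S × V` (`min`-parity).
Player 0 is Duplicator; all positions belong to Spoiler. -/
def rhGame (G' : GameGraph (S × V)) (c : S × V → ℕ) : InfGame ((S × V) × (S × V) × Option ℕ) where
  V0 := ∅
  edge a b := G'.edge a.1 b.1 ∧ G'.edge a.2.1 b.2.1 ∧ b.1.2 = b.2.1.2 ∧
    b.2.2 = pm (c b.1) (c b.2.1) a.2.2
  win := {ρ | (infOcc ρ ∩ {a | a.2.2 = none}).Nonempty}

open Classical in
noncomputable def rhInit (c : S × V → ℕ) (p q : S × V) : (S × V) × (S × V) × Option ℕ :=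
  (p, q, if rewardLT (c p) (c q) then some (min (c p) (c q)) else none)

/-- `q` right-hand delayed simulates `p`. -/
def rhLE (G' : GameGraph (S × V)) (c : S × V → ℕ) (p q : S × V) : Prop :=
  (rhGame G' c).Wins (rhInit c p q)

def rhEquiv (G' : GameGraph (S × V)) (c : S × V → ℕ) (p q : S × V) : Prop :=
  rhLE G' c p q ∧ rhLE G' c q p

/-- The relation on memory contents derived from right-hand delayed simulation. -/
def memEquiv (G' : GameGraph (S × V)) (c : S × V → ℕ) (s₁ s₂ : S) : Prop :=
  ∀ v : V, rhEquiv G' c (s₁, v) (s₂, v)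

/-- States of game automata: the states `S × V` of a game, an initial state and a sink. -/
inductive AutState (Q : Type) where
  | start : AutState Q
  | sink : AutState Q
  | state (q : Q) : AutState Q

/-- The transitions `(state, letter, state)` of the game automaton of the arena `G'` over `S × V`,
where `G` is the simulated arena and `s₀` the initial memory content. -/
inductive gameAutomaton (G : GameGraph V) (G' : GameGraph (S × V)) (s₀ : S) :
    AutState (S × V) → V → AutState (S × V) → Prop where
  | start (v' : V) : gameAutomaton G G' s₀ .start v' (.state (s₀, v'))
  | edge (s s' : S) (v v' : V) (h : G'.edge (s, v) (s', v')) :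
      gameAutomaton G G' s₀ (.state (s, v)) v' (.state (s', v'))
  | toSink (s : S) (v v' : V) (h : ¬ G.edge v v') : gameAutomaton G G' s₀ (.state (s, v)) v' .sink
  | sink (v' : V) : gameAutomaton G G' s₀ .sink v' .sink

/-- The classes of a relation on `S`, as subsets of `S`. -/
def MemClass (R : S → S → Prop) : Type := {C : Set S // ∃ s, C = {t | R s t}}

def MemClass.mk (R : S → S → Prop) (s : S) : MemClass R := ⟨{t | R s t}, s, rfl⟩

/-- The transitions of the quotient of the automaton `δ` (with initial memory content `s₀`) by a
relation on the memory contents. The successor of a class is the class of the least successor of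
its elements, with respect to a fixed total order on `S`. -/
inductive quotientAutomaton [LinearOrder S] (G : GameGraph V) (s₀ : S)
    (δ : AutState (S × V) → V → AutState (S × V) → Prop) (R : S → S → Prop) :
    AutState (MemClass R × V) → V → AutState (MemClass R × V) → Prop where
  | start (v' : V) : quotientAutomaton G s₀ δ R .start v' (.state (MemClass.mk R s₀, v'))
  | edge (C : MemClass R) (v v' : V) (t : S) (h : G.edge v v')
      (ht : IsLeast {t | ∃ s ∈ C.1, δ (.state (s, v)) v' (.state (t, v'))} t) :
      quotientAutomaton G s₀ δ R (.state (C, v)) v' (.state (MemClass.mk R t, v'))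
  | toSink (C : MemClass R) (v v' : V) (h : ¬ G.edge v v') :
      quotientAutomaton G s₀ δ R (.state (C, v)) v' .sink
  | sink (v' : V) : quotientAutomaton G s₀ δ R .sink v' .sink

/-- The arena of the automaton game of a game automaton. -/
def automatonGraph (V0 : Set V) (δ : AutState (S × V) → V → AutState (S × V) → Prop) :
    GameGraph (S × V) where
  V0 := {p | p.2 ∈ V0}
  edge p q := ∃ a : V, δ (.state p) a (.state q)

end Reduction

/-- An arena with vertex set `Mem × V`; the elements of `Mem` are its memory contents. -/
structure MemoryGraph (V : Type) where
  Mem : Type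
  graph : GameGraph (Mem × V)

/-- The reduced game graph that memory reduction computes for a Streett game: simulate it by a parity
game, view this as a game automaton with the complemented colouring (a `min`-parity automaton),
reduce the automaton by right-hand delayed simulation, and view the quotient as a game again. -/
def StreettGame.reducedGraph {V : Type} {m : ℕ} [LinearOrder (IAR m)] (Γ : StreettGame V m) :
    MemoryGraph V where
  Mem := MemClass (memEquiv Γ.iarGraph (fun p => 2 * (m + 1) - iarColor p))
  graph := automatonGraph Γ.V0 (quotientAutomaton Γ.toGameGraph (IAR.initial m)
    (gameAutomaton Γ.toGameGraph Γ.iarGraph (IAR.initial m))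
    (memEquiv Γ.iarGraph (fun p => 2 * (m + 1) - iarColor p)))

/-! ### The example -/

/-- The vertices of `G_k`. The numbers `1, …, k` are represented by `Fin k`. The vertices
`p j true`, `p j false` are the upper and the lower successor of `v j`, and `r j true`, `r j false`
are the upper and the lower successor of `w j`. -/
inductive Vert (k : ℕ) where
  | v (j : Fin k) : Vert k
  | p (j : Fin k) (up : Bool) : Vert k
  | w (j : Fin k) : Vert k
  | r (j : Fin k) (up : Bool) : Vert k
  | x : Vert k
  | y : Vert k

/-- The edges of `G_k`. -/
inductive exEdge (k : ℕ) : Vert k → Vert k → Prop where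
  | v_p (j : Fin k) (up : Bool) : exEdge k (.v j) (.p j up)
  | p_v (i j : Fin k) (up : Bool) (h : (i : ℕ) + 1 = j) : exEdge k (.p i up) (.v j)
  | p_w (i j : Fin k) (up : Bool) (hi : (i : ℕ) + 1 = k) (hj : (j : ℕ) = 0) :
      exEdge k (.p i up) (.w j)
  | w_r (j : Fin k) (up : Bool) : exEdge k (.w j) (.r j up)
  | r_w (i j : Fin k) (up : Bool) (h : (i : ℕ) + 1 = j) : exEdge k (.r i up) (.w j)
  | r_x (i : Fin k) (up : Bool) (hi : (i : ℕ) + 1 = k) : exEdge k (.r i up) .x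
  | x_y : exEdge k .x .y
  | y_v (j : Fin k) (hj : (j : ℕ) = 0) : exEdge k .y (.v j)

/-- The pairs are listed in the order `1, -1, 2, -2, …, k, -k`, followed by the pair `(V, V)`. -/
def idxPos {k : ℕ} (j : Fin k) : Fin (2 * k + 1) := ⟨2 * j, by omega⟩

def idxNeg {k : ℕ} (j : Fin k) : Fin (2 * k + 1) := ⟨2 * j + 1, by omega⟩

/-- The `E`-labels of the vertices, apart from the one of the pair `(V, V)`. -/
def labelE {k : ℕ} : Vert k → Set (Fin (2 * k + 1))
  | .p j true => {idxNeg j}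
  | .p j false => {idxPos j}
  | .r j true => {idxPos j}
  | .r j false => {idxNeg j}
  | .y => Set.univ
  | _ => ∅

/-- The `F`-labels of the vertices, apart from the one of the pair `(V, V)`. -/
def labelF {k : ℕ} : Vert k → Set (Fin (2 * k + 1))
  | .p j true => {idxPos j}
  | .p j false => {idxNeg j}
  | .r j true => {idxNeg j}
  | .r j false => {idxPos j}
  | _ => ∅

/-- The Streett game `Γ_k`. -/
def exGame (k : ℕ) : StreettGame (Vert k) (2 * k) where
  V0 := Set.range Vert.w
  edge := exEdge k
  E i := {u | i = Fin.last (2 * k) ∨ i ∈ labelE u}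
  F i := {u | i = Fin.last (2 * k) ∨ i ∈ labelF u}

/-!
Every round of `Γ_k` passes through `y`, which belongs to all the sets `E i`. So Player 0 wins every
play of `Γ_k`, and every play of the simulating game has the colour `0` of the complemented
colouring infinitely often. Duplicator, whose colour that is, then resets the memory to the check
mark again and again, wherever she starts, so all memory contents are equivalent.

For the memory bound, let Player 1 choose the vertices `p j (b j)` in the first round. Leaving the
vertex `p j (b j)` moves one of the two indices `±j` in front of the other one, and this order stays
as it is until the play reaches `r j`. If Player 0 went to `r j (!b j)`, which lies in the `F`-set
of the rear one of the two but only in `E`-sets of indices in front of it, then the `F`-pointer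
would move beyond the `E`-pointer, which gives an odd colour. Hence she copies the bits `b j`, all
of which she has to know when the play arrives at `w 0`: an automaton in the same state for `b` and
`b'` would from there on make the same moves.
-/

/-! ### Infinite plays -/

theorem frequently_of_forall_not_imp_lt {α : Type*} [Preorder α] [WellFoundedLT α] {P : ℕ → Prop}
    {d : ℕ → α} (h : ∀ i, ¬ P i → d (i + 1) < d i) : ∃ᶠ i in Filter.atTop, P i := by
  refine Filter.frequently_atTop.2 fun N => ?_
  by_contra! hN
  exact not_strictAnti_of_wellFoundedLT (fun i => d (N + i)) <|
    strictAnti_nat_of_succ_lt fun i => h (N + i) (hN (N + i) (Nat.le_add_right N i))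

theorem infOcc_inter_nonempty_of_frequently {V : Type} {ρ : ℕ → V} {T : Set V} (hT : T.Finite)
    (h : ∃ᶠ i in Filter.atTop, ρ i ∈ T) : (infOcc ρ ∩ T).Nonempty := by
  have hex : ∃ᶠ i in Filter.atTop, ∃ v ∈ T, ρ i = v := by simpa using h
  obtain ⟨v, hv, hρ⟩ := (Filter.frequently_exists_finite hT).1 hex
  exact ⟨v, hρ, hv⟩

theorem foldl_pastOf_succ {V M : Type} (g : M → V → M) (a : M) (ρ : ℕ → V) (i : ℕ) :
    (pastOf ρ (i + 1)).foldl g a = g ((pastOf ρ i).foldl g a) (ρ i) := by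
  simp [pastOf, List.range_succ]

namespace GameGraph

variable {V : Type} {G : GameGraph V} {f : V → V} {ρ : ℕ → V}

theorem mem_reachableUnder_of_positionalEdge (h : ∀ i, G.positionalEdge f (ρ i) (ρ (i + 1)))
    (i : ℕ) : ρ i ∈ G.reachableUnder f (ρ 0) := by
  induction i with
  | zero => exact .refl
  | succ i ih => exact ih.tail (h i)

theorem mem_determinedEdges_of_mem_V0 (h : ∀ i, G.positionalEdge f (ρ i) (ρ (i + 1))) {i : ℕ}
    (hi : ρ i ∈ G.V0) : (ρ (i + 1), ρ (i + 2)) ∈ G.determinedEdges f (ρ 0) :=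
  ⟨mem_reachableUnder_of_positionalEdge h _, h (i + 1),
    .inr ⟨ρ i, mem_reachableUnder_of_positionalEdge h i, hi, ((h i).2 hi).symm⟩⟩

/-- The plays from `v` according to a strategy `f` of Player 0. -/
structure IsPlayFrom (G : GameGraph V) (f : List V → V → V) (v : V) (ρ : ℕ → V) : Prop where
  isPlay : G.IsPlay ρ
  zero : ρ 0 = v
  playedAccordingTo : G.PlayedAccordingTo f ρ

end GameGraph

/-! ### Lower bounds on memory -/

section Memory

variable {V : Type} {G : GameGraph V} {f : List V → V → V} {v : V}

/-- The state in which an automaton reads `ρ i` on the play `ρ`. -/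
def Mealy.stateAt (M : Mealy V) (ρ : ℕ → V) (i : ℕ) : M.Mem := (pastOf ρ i).foldl M.next M.init

theorem Mealy.stateAt_succ (M : Mealy V) (ρ : ℕ → V) (i : ℕ) :
    M.stateAt ρ (i + 1) = M.next (M.stateAt ρ i) (ρ i) :=
  foldl_pastOf_succ _ _ _ _

theorem Mealy.Implements.out_stateAt {M : Mealy V} (hM : M.Implements G f v) {ρ : ℕ → V}
    (hρ : G.IsPlayFrom f v ρ) {i : ℕ} (hi : ρ i ∈ G.V0) :
    M.out (M.stateAt ρ i) (ρ i) = ρ (i + 1) :=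
  (hM ρ hρ.isPlay hρ.zero hρ.playedAccordingTo i hi).trans (hρ.playedAccordingTo i hi).symm

theorem Mealy.Implements.eq_of_stateAt_eq {M : Mealy V} (hM : M.Implements G f v) {ρ ρ' : ℕ → V}
    (hρ : G.IsPlayFrom f v ρ) (hρ' : G.IsPlayFrom f v ρ') {N L : ℕ} (hN : ρ N = ρ' N)
    (hstate : M.stateAt ρ N = M.stateAt ρ' N)
    (hmove : ∀ i, N ≤ i → i < L → ρ i = ρ' i → ρ i ∉ G.V0 → ρ (i + 1) = ρ' (i + 1))
    (i : ℕ) (hi : N ≤ i) (hL : i ≤ L) : ρ i = ρ' i := by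
  suffices h : ρ i = ρ' i ∧ M.stateAt ρ i = M.stateAt ρ' i from h.1
  induction i, hi using Nat.le_induction with
  | base => exact ⟨hN, hstate⟩
  | succ i hi ih =>
    obtain ⟨heq, hst⟩ := ih (by omega)
    refine ⟨?_, by rw [M.stateAt_succ, M.stateAt_succ, heq, hst]⟩
    by_cases hV0 : ρ i ∈ G.V0
    · rw [← hM.out_stateAt hρ hV0, ← hM.out_stateAt hρ' (heq ▸ hV0), heq, hst]
    · exact hmove i hi hL heq hV0

theorem memorySizeAtLeast_natCard {B : Type*} {ρ : B → ℕ → V} {N L : ℕ}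
    (hρ : ∀ b, G.IsPlayFrom f v (ρ b)) (hN : ∀ b b', ρ b N = ρ b' N)
    (hmove : ∀ b b' i, N ≤ i → i < L → ρ b i = ρ b' i → ρ b i ∉ G.V0 →
      ρ b (i + 1) = ρ b' (i + 1))
    (hinj : ∀ b b', (∀ i, N ≤ i → i ≤ L → ρ b i = ρ b' i) → b = b') :
    memorySizeAtLeast G f v (Nat.card B) := fun M _ hM =>
  Nat.card_le_card_of_injective (fun b => M.stateAt (ρ b) N) fun b b' hst =>
    hinj b b' (hM.eq_of_stateAt_eq (hρ b) (hρ b') (hN b b') hst (hmove b b'))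

end Memory

/-! ### Index appearance records -/

theorem tupleSort_symm_lt_iff {α : Type*} [LinearOrder α] {n : ℕ} (g : Fin n → α) (l l' : Fin n) :
    (Tuple.sort g).symm l < (Tuple.sort g).symm l' ↔ g l < g l' ∨ g l = g l' ∧ l < l' := by
  have hmono := (Tuple.eq_sort_iff' (f := g)).1 rfl
  rw [← hmono.lt_iff_lt]
  simp only [Equiv.trans_apply, Equiv.apply_symm_apply]
  exact Prod.Lex.lt_iff

theorem equiv_fin_apply_le_of_forall_lt {α : Type*} {n : ℕ} (σ τ : α ≃ Fin n) {b : α}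
    (h : ∀ c, σ c < σ b → τ c < τ b) : σ b ≤ τ b := by
  have hcard : (Finset.Iio (σ b)).card ≤ (Finset.Iio (τ b)).card :=
    Finset.card_le_card_of_injOn (fun d => τ (σ.symm d))
      (fun d hd => by simpa using h (σ.symm d) (by simpa using hd))
      (τ.injective.comp σ.symm.injective).injOn
  simpa using hcard

instance (m : ℕ) : Finite (IAR m) :=
  Finite.of_injective (fun s : IAR m => (s.perm, s.e, s.f)) fun ⟨_, _, _⟩ ⟨_, _, _⟩ h => by
    simpa using h

/-- The index `a` stands to the left of the index `b`. -/
def IAR.Before {m : ℕ} (s : IAR m) (a b : Fin (m + 1)) : Prop := s.perm.symm a < s.perm.symm b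

theorem odd_iarColor_iff {V : Type} {m : ℕ} {p : IAR m × V} :
    Odd (iarColor p) ↔ p.1.e < p.1.f := by
  rw [iarColor]
  split_ifs with h
  · exact iff_of_false (Nat.not_odd_iff_even.2 (even_two_mul _)) (not_lt.2 h)
  · exact iff_of_true ⟨p.1.f, by omega⟩ (not_le.1 h)

namespace StreettGame

variable {V : Type} {m : ℕ} (Γ : StreettGame V m) {a b : Fin (m + 1)}

theorem before_update_iff (s : IAR m) (v : V) :
    (Γ.update s v).Before a b ↔
      (v ∈ Γ.E a ∧ v ∉ Γ.E b) ∨ ((v ∈ Γ.E a ↔ v ∈ Γ.E b) ∧ s.Before a b) := by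
  classical
  have hsort := tupleSort_symm_lt_iff (fun l => if v ∈ Γ.E (s.perm l) then (0 : ℕ) else 1)
    (s.perm.symm a) (s.perm.symm b)
  simp only [Equiv.apply_symm_apply] at hsort
  refine (show (Γ.update s v).Before a b ↔ _ from hsort).trans ?_
  by_cases ha : v ∈ Γ.E a <;> by_cases hb : v ∈ Γ.E b <;> simp [ha, hb, IAR.Before]

theorem perm_symm_le_update_perm_symm (s : IAR m) {v : V} (hb : v ∉ Γ.E b) :
    s.perm.symm b ≤ (Γ.update s v).perm.symm b :=
  equiv_fin_apply_le_of_forall_lt _ _ fun c hc =>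
    (Γ.before_update_iff s v).2 <| (em (v ∈ Γ.E c)).imp (⟨·, hb⟩) (⟨iff_of_false · hb, hc⟩)

theorem update_e_lt {s : IAR m} {v : V} (hne : ∃ a, v ∈ Γ.E a)
    (hE : ∀ a, v ∈ Γ.E a → s.Before a b) : (Γ.update s v).e < s.perm.symm b := by
  classical
  obtain ⟨a, ha⟩ := hne
  refine (Finset.sup_lt_iff (bot_le.trans_lt (hE a ha))).2 fun l hl => ?_
  simpa [IAR.Before] using hE _ (Finset.mem_filter.1 hl).2

theorem le_update_f (s : IAR m) {v : V} (hb : v ∈ Γ.F b) :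
    (Γ.update s v).perm.symm b ≤ (Γ.update s v).f := by
  classical
  refine Finset.le_sup (f := id) (Finset.mem_filter.2 ⟨Finset.mem_univ _, ?_⟩)
  rwa [show Γ.shiftLeft v s.perm ((Γ.update s v).perm.symm b) = b from
    (Γ.update s v).perm.apply_symm_apply b]

theorem odd_iarColor_update {s : IAR m} {v : V} (u : V) (hF : v ∈ Γ.F b) (hne : ∃ a, v ∈ Γ.E a)
    (hE : ∀ a, v ∈ Γ.E a → s.Before a b) : Odd (iarColor (Γ.update s v, u)) :=
  odd_iarColor_iff.2 <| calc
    (Γ.update s v).e < s.perm.symm b := Γ.update_e_lt hne hE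
    _ ≤ (Γ.update s v).perm.symm b :=
      Γ.perm_symm_le_update_perm_symm s fun hb => lt_irrefl _ (hE b hb)
    _ ≤ (Γ.update s v).f := Γ.le_update_f s hF

theorem iarColor_update_of_forall_mem (s : IAR m) {v : V} (u : V) (h : ∀ i, v ∈ Γ.E i) :
    iarColor (Γ.update s v, u) = 2 * (m + 1) := by
  classical
  have he : (Γ.update s v).e = Fin.last m :=
    Fin.last_le_iff.1 <| Finset.le_sup (f := id) (b := Fin.last m) <|
      Finset.mem_filter.2 ⟨Finset.mem_univ _, h _⟩
  simp [iarColor, he, Fin.le_last]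

variable {Γ}

theorem before_of_mem_of_notMem {ρ : ℕ → IAR m × V} (hρ : Γ.iarGraph.IsPlay ρ) {t n : ℕ}
    (ha : (ρ t).2 ∈ Γ.E a) (hb : (ρ t).2 ∉ Γ.E b)
    (hstay : ∀ i, t < i → i < n → (ρ i).2 ∈ Γ.E b → (ρ i).2 ∈ Γ.E a) (htn : t < n) :
    (ρ n).1.Before a b := by
  induction n, htn using Nat.le_induction with
  | base =>
    rw [(hρ t).2, before_update_iff]
    exact .inl ⟨ha, hb⟩
  | succ n hn ih =>
    have ih := ih fun i hi hin => hstay i hi (by omega)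
    rw [(hρ n).2, before_update_iff]
    by_cases hbn : (ρ n).2 ∈ Γ.E b
    · exact .inr ⟨iff_of_true (hstay n hn (by omega) hbn) hbn, ih⟩
    · exact (em ((ρ n).2 ∈ Γ.E a)).imp (⟨·, hbn⟩) (⟨iff_of_false · hbn, ih⟩)

/-- The plays of the simulating game from the initial memory content and `v` in which Player 0
follows `f'` and Player 1 chooses his moves by `g`. -/
structure IsPlayAgainst (Γ : StreettGame V m) (f' : IAR m × V → IAR m × V) (g : V → V) (v : V)
    (ρ : ℕ → IAR m × V) : Prop where
  zero : ρ 0 = (IAR.initial m, v)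
  positionalEdge : ∀ i, Γ.iarGraph.positionalEdge f' (ρ i) (ρ (i + 1))
  snd_succ : ∀ i, (ρ i).2 ∉ Γ.V0 → (ρ (i + 1)).2 = g (ρ i).2

variable {f' : IAR m × V → IAR m × V} {g : V → V} {v : V} {ρ : ℕ → IAR m × V}

theorem exists_isPlayAgainst (hf : Γ.iarGraph.IsPositionalStrategy f')
    (hg : ∀ u ∉ Γ.V0, Γ.edge u (g u)) (v : V) : ∃ ρ, Γ.IsPlayAgainst f' g v ρ := by
  classical
  let step (p : IAR m × V) : IAR m × V := if p.2 ∈ Γ.V0 then f' p else (Γ.update p.1 p.2, g p.2)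
  have hstep (p) : Γ.iarGraph.positionalEdge f' p (step p) := by
    by_cases hp : p.2 ∈ Γ.V0
    · simp only [step, if_pos hp]
      exact ⟨hf p hp, fun _ => rfl⟩
    · simp only [step, if_neg hp]
      exact ⟨⟨hg _ hp, rfl⟩, fun h => absurd h hp⟩
  refine ⟨fun i => step^[i] (IAR.initial m, v), rfl, fun i => ?_, fun i hi => ?_⟩
  · rw [Function.iterate_succ_apply']
    exact hstep _
  · rw [Function.iterate_succ_apply']
    simp only [step, if_neg hi]

namespace IsPlayAgainst

theorem isPlay (hρ : Γ.IsPlayAgainst f' g v ρ) : Γ.iarGraph.IsPlay ρ :=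
  fun i => (hρ.positionalEdge i).1

theorem foldl_update_pastOf (hρ : Γ.IsPlayAgainst f' g v ρ) (i : ℕ) :
    (pastOf (fun i => (ρ i).2) i).foldl Γ.update (IAR.initial m) = (ρ i).1 := by
  induction i with
  | zero => rw [hρ.zero]; rfl
  | succ i ih => rw [foldl_pastOf_succ, ih, (hρ.isPlay i).2]

theorem isPlayFrom_snd (hρ : Γ.IsPlayAgainst f' g v ρ) :
    Γ.IsPlayFrom (Γ.inducedStrategy f') v fun i => (ρ i).2 where
  isPlay i := (hρ.isPlay i).1
  zero := by rw [hρ.zero]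
  playedAccordingTo i hi := by
    rw [inducedStrategy, hρ.foldl_update_pastOf]
    exact congrArg Prod.snd ((hρ.positionalEdge i).2 hi)

end IsPlayAgainst

theorem inducedStrategy_isStrategy (hf : Γ.iarGraph.IsPositionalStrategy f') :
    Γ.IsStrategy (Γ.inducedStrategy f') :=
  fun _ v _ hv => (hf (_, v) hv).1

end StreettGame

/-! ### Streett games in which all requests are answered -/

theorem pm_zero_right (i : ℕ) (o : Option ℕ) : pm i 0 o = none := by
  have hlt : ¬ rewardLT i 0 := by simp [rewardLT, rewardLE]
  cases o <;> simp [pm, hlt]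

theorem rhLE_of_frequently_eq_zero {S V : Type} [Finite S] [Finite V] {G' : GameGraph (S × V)}
    {c : S × V → ℕ} (p : S × V) {q : S × V}
    (hq : ∀ ρ, G'.IsPlay ρ → ρ 0 = q → ∃ᶠ i in Filter.atTop, c (ρ i) = 0) : rhLE G' c p q := by
  refine ⟨fun _ a => a, fun _ _ _ ha => absurd ha (Set.notMem_empty _), fun ρ hρ h0 _ => ?_⟩
  refine infOcc_inter_nonempty_of_frequently ?_ ?_
  · refine (Set.finite_range fun a : (S × V) × (S × V) => (a.1, a.2, (none : Option ℕ))).subset ?_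
    rintro ⟨p, q, o⟩ (rfl : o = none)
    exact ⟨(p, q), rfl⟩
  · have hzero := hq (fun i => (ρ i).2.1) (fun i => (hρ i).2.1) (by rw [h0]; rfl)
    refine (hzero.and_eventually (Filter.eventually_ge_atTop 1)).mono ?_
    rintro (_ | i) ⟨hc, hi⟩
    · omega
    · obtain ⟨-, -, -, hpm⟩ := hρ i
      rwa [hc, pm_zero_right] at hpm

theorem natCard_memClass_eq_one {S : Type} [Nonempty S] {R : S → S → Prop} (h : ∀ s t, R s t) :
    Nat.card (MemClass R) = 1 := by
  refine Nat.card_eq_one_iff_exists.2 ⟨MemClass.mk R (Classical.arbitrary S), ?_⟩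
  rintro ⟨C, s, rfl⟩
  exact Subtype.ext (by simp [MemClass.mk, h])

/-- Every play visits infinitely often vertices that belong to all the sets `E j`; such a vertex
answers the requests of all pairs at once. -/
def StreettGame.AlwaysAnswers {V : Type} {m : ℕ} (Γ : StreettGame V m) : Prop :=
  ∀ ρ, Γ.IsPlay ρ → ∃ᶠ i in Filter.atTop, ∀ j, ρ i ∈ Γ.E j

namespace StreettGame.AlwaysAnswers

variable {V : Type} {m : ℕ} {Γ : StreettGame V m}

theorem isWinningStrategy [Finite V] (hΓ : Γ.AlwaysAnswers) {f : List V → V → V}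
    (hf : Γ.IsStrategy f) (v : V) : Γ.game.IsWinningStrategy f v :=
  ⟨hf, fun ρ hρ _ _ j _ =>
    infOcc_inter_nonempty_of_frequently (Set.toFinite _) ((hΓ ρ hρ).mono fun _ h => h j)⟩

theorem frequently_iarColor_eq (hΓ : Γ.AlwaysAnswers) {ρ : ℕ → IAR m × V}
    (hρ : Γ.iarGraph.IsPlay ρ) : ∃ᶠ i in Filter.atTop, iarColor (ρ i) = 2 * (m + 1) := by
  refine (Filter.tendsto_add_atTop_nat 1).frequently ?_
  refine (hΓ (fun i => (ρ i).2) fun i => (hρ i).1).mono fun i hi => ?_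
  rw [← Γ.iarColor_update_of_forall_mem (ρ i).1 (ρ (i + 1)).2 hi, ← (hρ i).2]

theorem natCard_mem_reducedGraph [Finite V] (hΓ : Γ.AlwaysAnswers) [LinearOrder (IAR m)] :
    Nat.card Γ.reducedGraph.Mem = 1 := by
  have : Nonempty (IAR m) := ⟨IAR.initial m⟩
  have hle (p q : IAR m × V) : rhLE Γ.iarGraph (fun p => 2 * (m + 1) - iarColor p) p q :=
    rhLE_of_frequently_eq_zero p fun ρ hρ _ =>
      (hΓ.frequently_iarColor_eq hρ).mono fun i hi => by rw [hi, Nat.sub_self]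
  exact natCard_memClass_eq_one fun s t v => ⟨hle (s, v) (t, v), hle (t, v) (s, v)⟩

end StreettGame.AlwaysAnswers

/-! ### The games `Γ_k` -/

section Example

variable {k : ℕ}

instance : Finite (Vert k) := by
  have hfin := ((Set.finite_range (Vert.v (k := k))).union
    (Set.finite_range fun a : Fin k × Bool => Vert.p a.1 a.2)).union
    (((Set.finite_range (Vert.w (k := k))).union
    (Set.finite_range fun a : Fin k × Bool => Vert.r a.1 a.2)).union
    (Set.toFinite {Vert.x, Vert.y}))
  refine Set.finite_univ_iff.1 (hfin.subset fun u _ => ?_)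
  cases u <;> simp

/-- The distance to the vertex `y`. -/
def Vert.distY : Vert k → ℕ
  | .v j => 2 * k + 2 * (k - j) + 1
  | .p j _ => 2 * k + 2 * (k - j)
  | .w j => 2 * (k - j) + 1
  | .r j _ => 2 * (k - j)
  | .x => 1
  | .y => 0

theorem exEdge.distY_add_one {u u' : Vert k} (h : exEdge k u u') (hu : u ≠ .y) :
    u'.distY + 1 = u.distY := by
  cases h <;> simp only [Vert.distY] <;> first | omega | exact absurd rfl hu

theorem exGame_alwaysAnswers (k : ℕ) : (exGame k).AlwaysAnswers := by
  intro ρ hρ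
  have hy : ∃ᶠ i in Filter.atTop, ρ i = .y :=
    frequently_of_forall_not_imp_lt (d := fun i => (ρ i).distY) fun i hi =>
      Nat.lt_of_succ_le ((hρ i).distY_add_one hi).le
  exact hy.mono fun i hi j => hi ▸ .inr (Set.mem_univ j)

/-- The index `j` or `-j`. -/
def idxSigned (j : Fin k) : Bool → Fin (2 * k + 1)
  | true => idxPos j
  | false => idxNeg j

theorem idxSigned_inj {i j : Fin k} {a b : Bool} :
    idxSigned i a = idxSigned j b ↔ i = j ∧ a = b := by
  cases a <;> cases b <;> simp [idxSigned, idxPos, idxNeg, Fin.ext_iff] <;> omega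

theorem idxSigned_ne_last (j : Fin k) (a : Bool) : idxSigned j a ≠ Fin.last (2 * k) := by
  cases a <;> simp [idxSigned, idxPos, idxNeg, Fin.ext_iff] <;> omega

theorem v_mem_E_iff {j : Fin k} {i : Fin (2 * k + 1)} :
    Vert.v j ∈ (exGame k).E i ↔ i = Fin.last (2 * k) := by
  simp [exGame, labelE]

theorem p_mem_E_iff {j : Fin k} {a : Bool} {i : Fin (2 * k + 1)} :
    Vert.p j a ∈ (exGame k).E i ↔ i = Fin.last (2 * k) ∨ i = idxSigned j (!a) := by
  cases a <;> rfl

theorem r_mem_E_iff {j : Fin k} {a : Bool} {i : Fin (2 * k + 1)} :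
    Vert.r j a ∈ (exGame k).E i ↔ i = Fin.last (2 * k) ∨ i = idxSigned j a := by
  cases a <;> rfl

theorem r_mem_F_iff {j : Fin k} {a : Bool} {i : Fin (2 * k + 1)} :
    Vert.r j a ∈ (exGame k).F i ↔ i = Fin.last (2 * k) ∨ i = idxSigned j (!a) := by
  cases a <;> rfl

theorem distY_of_mem_E_idxSigned {u : Vert k} {j : Fin k} {a : Bool}
    (h : u ∈ (exGame k).E (idxSigned j a)) :
    u.distY = 0 ∨ u.distY = 2 * (k - j) ∨ u.distY = 2 * k + 2 * (k - j) := by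
  cases u with
  | p i c =>
    obtain ⟨rfl, -⟩ := idxSigned_inj.1 ((p_mem_E_iff.1 h).resolve_left (idxSigned_ne_last j a))
    exact .inr (.inr rfl)
  | r i c =>
    obtain ⟨rfl, -⟩ := idxSigned_inj.1 ((r_mem_E_iff.1 h).resolve_left (idxSigned_ne_last j a))
    exact .inr (.inl rfl)
  | y => exact .inl rfl
  | _ => exact absurd h (by simp [exGame, labelE, idxSigned_ne_last])

/-- Moves along the edges of `G_k` among which `p j (b j)` is chosen at `v j`. -/
def challenge (hk : 1 ≤ k) (b : Fin k → Bool) : Vert k → Vert k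
  | .v j => .p j (b j)
  | .p j _ => if h : (j : ℕ) + 1 < k then .v ⟨j + 1, h⟩ else .w ⟨0, hk⟩
  | .w j => .r j true
  | .r j _ => if h : (j : ℕ) + 1 < k then .w ⟨j + 1, h⟩ else .x
  | .x => .y
  | .y => .v ⟨0, hk⟩

theorem exEdge_challenge (hk : 1 ≤ k) (b : Fin k → Bool) (u : Vert k) :
    exEdge k u (challenge hk b u) := by
  cases u with
  | v j => exact .v_p _ _
  | p j a =>
    rw [challenge]
    split_ifs with h
    · exact .p_v _ _ _ rfl
    · exact .p_w _ _ _ (by omega) rfl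
  | w j => exact .w_r _ _
  | r j a =>
    rw [challenge]
    split_ifs with h
    · exact .r_w _ _ _ rfl
    · exact .r_x _ _ (by omega)
  | x => exact .x_y
  | y => exact .y_v _ rfl

theorem exGame_wins (hk : 1 ≤ k) (u : Vert k) : (exGame k).game.Wins u :=
  ⟨fun _ => challenge hk fun _ => true, (exGame_alwaysAnswers k).isWinningStrategy
    (fun _ v _ _ => exEdge_challenge hk _ v) u⟩

section FirstRound

variable {hk : 1 ≤ k} {u : ℕ → Vert k}

theorem distY_add_of_isPlay (hu : (exGame k).IsPlay u) (h0 : u 0 = .v ⟨0, hk⟩) {i : ℕ}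
    (hi : i ≤ 4 * k + 1) : (u i).distY + i = 4 * k + 1 := by
  induction i with
  | zero => simp only [h0, Vert.distY]; omega
  | succ i ih =>
    have ih := ih (by omega)
    have hy : u i ≠ .y := fun h => by simp only [h, Vert.distY] at ih; omega
    have := (hu i).distY_add_one hy
    omega

theorem eq_v_of_isPlay (hu : (exGame k).IsPlay u) (h0 : u 0 = .v ⟨0, hk⟩) (j : Fin k) :
    u (2 * j) = .v j := by
  have h := distY_add_of_isPlay hu h0 (i := 2 * j) (by omega)
  generalize u (2 * j) = w at h
  cases w <;> simp only [Vert.distY, Vert.v.injEq, Fin.ext_iff, reduceCtorEq] at h ⊢ <;> omega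

theorem eq_w_of_isPlay (hu : (exGame k).IsPlay u) (h0 : u 0 = .v ⟨0, hk⟩) (j : Fin k) :
    u (2 * k + 2 * j) = .w j := by
  have h := distY_add_of_isPlay hu h0 (i := 2 * k + 2 * j) (by omega)
  generalize u (2 * k + 2 * j) = w at h
  cases w <;> simp only [Vert.distY, Vert.w.injEq, Fin.ext_iff, reduceCtorEq] at h ⊢ <;> omega

theorem exists_eq_r_of_isPlay (hu : (exGame k).IsPlay u) (h0 : u 0 = .v ⟨0, hk⟩) (j : Fin k) :
    ∃ a, u (2 * k + 2 * j + 1) = .r j a := by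
  have hedge : exEdge k (u (2 * k + 2 * j)) (u (2 * k + 2 * j + 1)) := hu _
  rw [eq_w_of_isPlay hu h0 j] at hedge
  generalize u (2 * k + 2 * j + 1) = w at hedge
  cases hedge
  exact ⟨_, rfl⟩

end FirstRound

theorem challenge_eq_challenge (hk : 1 ≤ k) (b b' : Fin k → Bool) {u : Vert k}
    (hu : u.distY ≤ 2 * k + 1) : challenge hk b u = challenge hk b' u := by
  cases u with
  | v j => simp only [Vert.distY] at hu; omega
  | _ => rfl

variable {hk : 1 ≤ k} {f' : IAR (2 * k) × Vert k → IAR (2 * k) × Vert k} {b : Fin k → Bool}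
  {ρ : ℕ → IAR (2 * k) × Vert k}

theorem snd_eq_p_of_isPlayAgainst
    (hρ : (exGame k).IsPlayAgainst f' (challenge hk b) (.v ⟨0, hk⟩) ρ) (j : Fin k) :
    (ρ (2 * j + 1)).2 = .p j (b j) := by
  have hv : (ρ (2 * j)).2 = .v j := eq_v_of_isPlay hρ.isPlayFrom_snd.isPlay hρ.isPlayFrom_snd.zero j
  rw [hρ.snd_succ _ (by simp [hv, exGame]), hv, challenge]

theorem before_of_isPlayAgainst
    (hρ : (exGame k).IsPlayAgainst f' (challenge hk b) (.v ⟨0, hk⟩) ρ) (j : Fin k) :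
    (ρ (2 * k + 2 * j + 1)).1.Before (idxSigned j (!b j)) (idxSigned j (b j)) := by
  have hp := snd_eq_p_of_isPlayAgainst hρ j
  refine StreettGame.before_of_mem_of_notMem hρ.isPlay (t := 2 * j + 1) ?_ ?_ ?_ (by omega)
  · simp [hp, p_mem_E_iff]
  · simp [hp, p_mem_E_iff, idxSigned_ne_last, idxSigned_inj]
  · intro i hi hin hmem
    have hdist := distY_of_mem_E_idxSigned hmem
    have hadd := distY_add_of_isPlay hρ.isPlayFrom_snd.isPlay hρ.isPlayFrom_snd.zero (i := i)
      (by omega)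
    omega

theorem last_before_of_isPlayAgainst
    (hρ : (exGame k).IsPlayAgainst f' (challenge hk b) (.v ⟨0, hk⟩) ρ) {n : ℕ} (hn : 0 < n)
    (j : Fin k) (a : Bool) : (ρ n).1.Before (Fin.last (2 * k)) (idxSigned j a) := by
  refine StreettGame.before_of_mem_of_notMem hρ.isPlay (t := 0) (.inl rfl) ?_
    (fun _ _ _ _ => .inl rfl) hn
  simp [hρ.zero, v_mem_E_iff, idxSigned_ne_last]

theorem snd_eq_r_of_isPlayAgainst
    (hρ : (exGame k).IsPlayAgainst f' (challenge hk b) (.v ⟨0, hk⟩) ρ)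
    (heven : ∀ a ∈ (exGame k).iarGraph.determinedEdges f' (IAR.initial (2 * k), .v ⟨0, hk⟩),
      ¬ Odd (iarColor a.2)) (j : Fin k) :
    (ρ (2 * k + 2 * j + 1)).2 = .r j (b j) := by
  have hplay := hρ.isPlayFrom_snd
  have hw : (ρ (2 * k + 2 * j)).2 = .w j := eq_w_of_isPlay hplay.isPlay hplay.zero j
  obtain ⟨a, hr : (ρ (2 * k + 2 * j + 1)).2 = .r j a⟩ :=
    exists_eq_r_of_isPlay hplay.isPlay hplay.zero j
  by_contra hne
  obtain rfl : a = !b j := Bool.eq_not.2 fun h => hne (h ▸ hr)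
  have hdet := GameGraph.mem_determinedEdges_of_mem_V0 hρ.positionalEdge
    (i := 2 * k + 2 * j) ⟨j, hw.symm⟩
  rw [hρ.zero] at hdet
  refine heven _ hdet ?_
  have hodd := (exGame k).odd_iarColor_update (s := (ρ (2 * k + 2 * j + 1)).1)
    (v := .r j (!b j)) (b := idxSigned j (b j)) (ρ (2 * k + 2 * j + 2)).2
    (r_mem_F_iff.2 (.inr (by rw [Bool.not_not]))) ⟨Fin.last _, .inl rfl⟩ fun c hc => ?_
  · rwa [← hr, ← (hρ.isPlay (2 * k + 2 * j + 1)).2] at hodd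
  · rcases r_mem_E_iff.1 hc with rfl | rfl
    · exact last_before_of_isPlayAgainst hρ (by omega) j _
    · exact before_of_isPlayAgainst hρ j

theorem two_pow_memorySizeAtLeast (hf : (exGame k).iarGraph.IsPositionalStrategy f')
    (heven : ∀ a ∈ (exGame k).iarGraph.determinedEdges f' (IAR.initial (2 * k), .v ⟨0, hk⟩),
      ¬ Odd (iarColor a.2)) :
    memorySizeAtLeast (exGame k).toGameGraph ((exGame k).inducedStrategy f') (.v ⟨0, hk⟩)
      (2 ^ k) := by
  choose ρ hρ using fun b : Fin k → Bool =>
    StreettGame.exists_isPlayAgainst hf (fun u _ => exEdge_challenge hk b u) (.v ⟨0, hk⟩)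
  have hplay (b) := (hρ b).isPlayFrom_snd
  have hcard : Nat.card (Fin k → Bool) = 2 ^ k := by simp
  rw [← hcard]
  refine memorySizeAtLeast_natCard (N := 2 * k) (L := 4 * k) hplay (fun b b' => ?_)
    (fun b b' i hi hiL heq hV0 => ?_) (fun b b' heq => funext fun j => ?_)
  · have hw (b) := eq_w_of_isPlay (hplay b).isPlay (hplay b).zero ⟨0, hk⟩
    exact (hw b).trans (hw b').symm
  · have hdist := distY_add_of_isPlay (hplay b).isPlay (hplay b).zero (i := i) (by omega)
    rw [(hρ b).snd_succ i hV0, (hρ b').snd_succ i (heq ▸ hV0), ← heq]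
    exact challenge_eq_challenge hk b b' (by omega)
  · have hr := heq (2 * k + 2 * j + 1) (by omega) (by omega)
    simp only [snd_eq_r_of_isPlayAgainst (hρ _) heven] at hr
    exact (Vert.r.inj hr).2

end Example

theorem mainTheorem2 (k : ℕ) (hk : 1 ≤ k) :
    (exGame k).game.Wins (Vert.v ⟨0, hk⟩) ∧
    (∀ f' : IAR (2 * k) × Vert k → IAR (2 * k) × Vert k,
      (exGame k).iarGraph.IsPositionalStrategy f' →
      (exGame k).simulatingGame.IsWinningStrategy (fun _ p => f' p)
        (IAR.initial (2 * k), Vert.v ⟨0, hk⟩) →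
      ((fun a => iarColor a.2) '' (exGame k).iarGraph.determinedEdges f'
        (IAR.initial (2 * k), Vert.v ⟨0, hk⟩)) ∩ {n | Odd n} = ∅ →
      (exGame k).game.IsWinningStrategy ((exGame k).inducedStrategy f') (Vert.v ⟨0, hk⟩) ∧
      memorySizeAtLeast (exGame k).toGameGraph ((exGame k).inducedStrategy f')
        (Vert.v ⟨0, hk⟩) (2 ^ k)) ∧
    (∀ [LinearOrder (IAR (2 * k))], Nat.card (exGame k).reducedGraph.Mem = 1) := by
  refine ⟨exGame_wins hk _, fun f' hf _ hcolor => ⟨?_, ?_⟩, ?_⟩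
  · exact (exGame_alwaysAnswers k).isWinningStrategy (StreettGame.inducedStrategy_isStrategy hf) _
  · refine two_pow_memorySizeAtLeast hf fun a ha hodd => ?_
    exact Set.eq_empty_iff_forall_notMem.1 hcolor _ ⟨⟨a, ha, rfl⟩, hodd⟩
  · exact (exGame_alwaysAnswers k).natCard_mem_reducedGraph
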